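/- Let $n=2^s$ and $q=2^r$ with positive integers $s,r$, and let $\mathbb F_q$ be the field with $q$ elements. Let $\operatorname{tr}(x)=x+x^2+\cdots+x^{2^{r-1}}$ be the trace $\mathbb F_q\to\mathbb F_2$ and $\lambda(x)=(-1)^{\operatorname{tr}(x)}$ the canonical additive character of $\mathbb F_q$. For $m\ge 0$ and $a\in\mathbb F_q^*$ put $$K_m(\lambda;a)=\sum_{\alpha_1,\dots,\alpha_m\in\mathbb F_q^*}\lambda(\alpha_1+\cdots+\alpha_m+a\,\alpha_1^{-1}\cdots\alpha_m^{-1}),\qquad K_0(\lambda;a)=\lambda(a),$$ and for $h\ge 0$ put $MK_m^h=\sum_{a\in\mathbb F_q^*}K_m(\lambda;a)^h$. Let $g_1,\dots,g_N$ be an ordering of the elements of $SL(n,q)$, $N=|SL(n,q)|$, let $$C=C(SL(n,q))=\Big\{u\in\mathbb F_2^N : \sum_{k=1}^N u_k\operatorname{Tr}(g_k)=0 \text{ in } \mathbb F_q\Big\},$$ where $\operatorname{Tr}$ is the matrix trace, and let $C_i$ be the number of codewords of Hamming weight $i$ in $C$. Binomial coefficients $\binom ba$ are $0$ unless $0\le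 a\le b$. Then for every positive integer $h$ $$q^{\binom n2 h}MK_{n-1}^h=\sum_{i=0}^{h-1}(-1)^{h+i+1}\binom hi N^{h-i}q^{\binom n2 i}MK_{n-1}^i+q\sum_{i=0}^{\min\{N,h\}}(-1)^{h+i}C_i\sum_{t=i}^{h}t!\,S(h,t)\,2^{h-t}\binom{N-i}{N-t}.$$ Here $N=q^{\binom n2}\prod_{j=2}^n(q^j-1)$, and $S(h,t)$ is the Stirling number of the second kind, given for $h\geq 1$ by $S(h,t)=\frac1{t!}\sum_{j=0}^t(-1)^{t-j}\binom tj j^h$. Moreover, for $0\le i\le N$, $$C_i=\sum\prod_{\beta\in\mathbb F_q}\binom{n_\beta}{\nu_\beta},$$ where the sum runs over all families $(\nu_\beta)_{\beta\in\mathbb F_q}$ of nonnegative integers with $\sum_\beta\nu_\beta=i$ and $\sum_\beta\nu_\beta\beta=0$ in $\mathbb F_q$, and, for every $\beta\in\mathbb F_q$, $$n_\beta=|\{g\in SL(n,q):\operatorname{Tr}(g)=\beta\}|=q^{\binom n2-1}\Big\{\prod_{j=2}^n(q^j-1)+1+q\,\theta(\beta)\Big\},$$ with $\theta(\beta)=K_{n-2}(\lambda;\beta^{-1})$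 for $\beta\ne 0$ and $\theta(0)=0$. -/

import Mathlib

/-- The canonical additive character `λ(x) = (-1)^{tr(x)}` of a finite field `F` of
characteristic two, where `tr : F → 𝔽₂` is the absolute trace. -/
noncomputable def canonicalChar (F : Type*) [Field F] [Fintype F] [Algebra (ZMod 2) F] :
    AddChar F ℂ where
  toFun x := (-1) ^ (Algebra.trace (ZMod 2) F x).val
  map_zero_eq_one' := by simp
  map_add_eq_mul' x y := by
    rw [map_add]
    generalize Algebra.trace (ZMod 2) F x = a
    generalize Algebra.trace (ZMod 2) F y = b
    rw [← pow_add]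
    refine neg_one_pow_congr ?_
    revert a b
    decide

/-- The absolute trace is `x + x² + ⋯ + x^{2^{r-1}}` on the field with `2^r` elements. -/
theorem algebraMap_trace_eq_sum (F : Type*) [Field F] [Fintype F] [Algebra (ZMod 2) F]
    (r : ℕ) (hF : Fintype.card F = 2 ^ r) (x : F) :
    algebraMap (ZMod 2) F (Algebra.trace (ZMod 2) F x) = ∑ i ∈ Finset.range r, x ^ 2 ^ i := by
  have hr : Module.finrank (ZMod 2) F = r := by
    have h := Module.card_eq_pow_finrank (K := ZMod 2) (V := F)
    rw [hF, ZMod.card] at h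
    exact (Nat.pow_right_injective le_rfl h).symm
  rw [FiniteField.algebraMap_trace_eq_sum_pow, hr]
  simp

/-- The `m`-dimensional Kloosterman sum `K_m(ψ; a)`, the sum of
`ψ(α₁ + ⋯ + α_m + a α₁⁻¹ ⋯ α_m⁻¹)` over all `α₁, …, α_m ∈ F^*`.
For `m = 0` there is exactly one (empty) tuple, so that `K_0(ψ; a) = ψ(a)`. -/
noncomputable def kloosterman {F : Type*} [Field F] [Fintype F] [DecidableEq F] (m : ℕ)
    (ψ : AddChar F ℂ) (a : Fˣ) : ℂ :=
  ∑ α : Fin m → Fˣ, ψ (∑ i, (α i : F) + (a : F) * ∏ i, (α i : F)⁻¹)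

/-- The `h`-th moment `MK_m^h` of the `m`-dimensional Kloosterman sums for the canonical
additive character. -/
noncomputable def kloostermanMoment (F : Type*) [Field F] [Fintype F] [DecidableEq F]
    [Algebra (ZMod 2) F] (m h : ℕ) : ℂ :=
  ∑ a : Fˣ, kloosterman m (canonicalChar F) a ^ h

/-- The binary code `C(SL(n,q)) = {u ∈ 𝔽₂^N | u · v = 0}` with
`v = (Tr g₁, …, Tr g_N) ∈ F^N`, for an ordering `g₁, …, g_N` of the elements of `SL(n,q)`. -/
def slCode {F : Type*} [Field F] [Algebra (ZMod 2) F] {n N : ℕ}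
    (g : Fin N ≃ Matrix.SpecialLinearGroup (Fin n) F) :
    Submodule (ZMod 2) (Fin N → ZMod 2) where
  carrier := {u | ∑ k, algebraMap (ZMod 2) F (u k) * Matrix.trace (g k).1 = 0}
  zero_mem' := by simp
  add_mem' {u w} hu hw := by
    simp only [Set.mem_ofPred_eq] at hu hw ⊢
    simp [add_mul, Finset.sum_add_distrib, hu, hw]
  smul_mem' c u hu := by
    simp only [Set.mem_ofPred_eq] at hu ⊢
    simp [mul_assoc, ← Finset.mul_sum, hu]

/-- The number of codewords of Hamming weight `i` in a binary code of length `N`. -/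
noncomputable def weightCount {N : ℕ} (C : Submodule (ZMod 2) (Fin N → ZMod 2)) (i : ℕ) : ℕ :=
  Nat.card {u : Fin N → ZMod 2 // u ∈ C ∧ hammingNorm u = i}

/-- The number `n_β` of elements of `SL(n,q)` with matrix trace `β`. -/
noncomputable def traceCount {F : Type*} [Field F] (n : ℕ) (β : F) : ℕ :=
  Nat.card {x : Matrix.SpecialLinearGroup (Fin n) F // Matrix.trace x.1 = β}

/-- `θ(β) = K_{n-2}(λ; β⁻¹)` for `β ≠ 0`, and `θ(0) = 0`; used for `n ≥ 2`. -/
noncomputable def theta {F : Type*} [Field F] [Fintype F] [DecidableEq F] [Algebra (ZMod 2) F]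
    (n : ℕ) (β : F) : ℂ :=
  if hβ : β = 0 then 0 else kloosterman (n - 2) (canonicalChar F) (Units.mk0 β hβ)⁻¹

/-- The families `(ν_β)` of nonnegative integers with `∑ ν_β = i` in `ℕ` and
`∑ ν_β β = 0` in `F`. -/
def admissible (F : Type*) [Field F] [Fintype F] [DecidableEq F] (i : ℕ) : Finset (F → ℕ) :=
  (Finset.piAntidiag Finset.univ i).filter fun ν => ∑ β, (ν β : F) * β = 0

/-- The binomial coefficient `binom(b, a)` of integers, which is `0` unless `0 ≤ a ≤ b`. -/
def intBinom (b a : ℤ) : ℕ :=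
  if 0 ≤ a ∧ a ≤ b then Nat.choose b.toNat a.toNat else 0

/-! For `a` in `F` let `w(a)` be the weight of the word `(tr(a Tr g_k))_k`. The recursion comes from
computing `∑_a (2 w(a))^h` in two ways.

On one side, `2 w(a) = N - ∑_g λ(a Tr g)`. Averaging over unipotent upper triangular matrices
reduces this Gauss sum to upper triangular matrices (`sum_det_eq_char_trace`), which gives `q^(n
choose 2) K_{n-1}(λ; a^n)` for `a ≠ 0`. As `n = 2^s` and `λ` is Frobenius-invariant, `a^n` may be
replaced by `a`. The binomial theorem then produces the moments.

On the other side, `w^h` is expanded in falling factorials, and `2^t (w choose t)` is a sum of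
products of factors `1 - λ(a v_k)`. Summing over `a` keeps only subsets with zero sum, which are the
codewords of `C` (`sum_two_mul_traceWeight_pow`). This is a Pless power moment identity; summing
over `a` rather than over words makes injectivity of `a ↦ word` irrelevant.

The same Gauss sum and Fourier inversion give `n_β`; sorting the indices of a zero-sum subset by
trace gives `C_i`. -/

/-! ### Stirling numbers of the second kind. -/

theorem Nat.mul_descFactorial_eq (w t : ℕ) :
    w * w.descFactorial t = w.descFactorial (t + 1) + t * w.descFactorial t := by
  rw [Nat.descFactorial_succ]
  rcases le_or_gt t w with h | h
  · rw [← add_mul, Nat.sub_add_cancel h]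
  · simp [Nat.descFactorial_of_lt h]

/-- Powers expand in falling factorials with Stirling numbers of the second kind. -/
theorem Nat.pow_eq_sum_stirlingSecond_mul_descFactorial (w h : ℕ) :
    w ^ h = ∑ t ∈ Finset.range (h + 1), h.stirlingSecond t * w.descFactorial t := by
  induction h with
  | zero => simp
  | succ h ih =>
    rw [pow_succ', ih, Finset.mul_sum, Finset.sum_range_succ' _ (h + 1)]
    simp only [Nat.stirlingSecond_succ_succ, Nat.stirlingSecond_succ_zero, zero_mul, add_zero,
      add_mul, Finset.sum_add_distrib]
    have h1 : ∀ t ∈ Finset.range (h + 1), w * (h.stirlingSecond t * w.descFactorial t) =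
        h.stirlingSecond t * w.descFactorial (t + 1) +
          t * h.stirlingSecond t * w.descFactorial t := by
      intro t _
      rw [mul_left_comm, Nat.mul_descFactorial_eq]
      ring
    rw [Finset.sum_congr rfl h1, Finset.sum_add_distrib, add_comm]
    congr 1
    -- Shifting the index costs nothing: the bottom term has the factor `t = 0`, the top one `S(h,
    -- h+1) = 0`.
    have h2 := Finset.sum_range_succ' (fun t => t * h.stirlingSecond t * w.descFactorial t) (h + 1)
    rw [Finset.sum_range_succ, Nat.stirlingSecond_eq_zero_of_lt (Nat.lt_succ_self h)] at h2
    simpa only [Nat.zero_mul, Nat.mul_zero, zero_mul, mul_zero, add_zero, add_mul, one_mul,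
      Finset.sum_add_distrib] using h2

/-- The explicit formula for `t! S(h, t)` as an alternating sum. -/
theorem Nat.factorial_mul_stirlingSecond (h t : ℕ) :
    (t.factorial * h.stirlingSecond t : ℚ) =
      ∑ j ∈ Finset.range (t + 1), (-1 : ℚ) ^ (t - j) * (t.choose j : ℚ) * (j : ℚ) ^ h := by
  induction h generalizing t with
  | zero =>
    have key := add_pow (1 : ℚ) (-1) t
    simp only [one_pow, one_mul] at key
    simp only [pow_zero, mul_one]
    rw [← key]
    cases t <;> simp
  | succ h ih =>
    cases t with
    | zero => simp
    | succ t =>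
      -- Absorption, `j C(t+1,j) = (t+1)(C(t+1,j) - C(t,j))`, mirrors the Stirling recursion.
      have h1 : ∀ j ∈ Finset.range (t + 1 + 1),
          (-1 : ℚ) ^ (t + 1 - j) * ((t + 1).choose j : ℚ) * (j : ℚ) ^ (h + 1) =
          (t + 1) * ((-1 : ℚ) ^ (t + 1 - j) * ((t + 1).choose j : ℚ) * (j : ℚ) ^ h) -
          (t + 1) * ((-1 : ℚ) ^ (t + 1 - j) * (t.choose j : ℚ) * (j : ℚ) ^ h) := by
        intro j hj
        have hj' : j ≤ t + 1 := Nat.lt_succ_iff.mp (Finset.mem_range.mp hj)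
        have h2 := Nat.choose_mul_succ_eq t j
        have h3 : (t.choose j : ℚ) * (t + 1) = ((t + 1).choose j : ℚ) * (t + 1 - j) := by
          rw [← Nat.cast_add_one, ← Nat.cast_sub hj']
          exact_mod_cast h2
        linear_combination ((-1 : ℚ) ^ (t + 1 - j) * (j : ℚ) ^ h) * h3
      have h4 : ∀ j ∈ Finset.range (t + 1),
          (t + 1 : ℚ) * ((-1 : ℚ) ^ (t + 1 - j) * (t.choose j : ℚ) * (j : ℚ) ^ h) =
          -((t + 1 : ℚ) * ((-1 : ℚ) ^ (t - j) * (t.choose j : ℚ) * (j : ℚ) ^ h)) := by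
        intro j hj
        rw [Nat.succ_sub (Nat.lt_succ_iff.mp (Finset.mem_range.mp hj)), pow_succ]
        ring
      rw [Finset.sum_congr rfl h1, Finset.sum_sub_distrib, ← Finset.mul_sum, ← ih (t + 1),
        Finset.sum_range_succ _ (t + 1), Finset.sum_congr rfl h4, Finset.sum_neg_distrib,
        ← Finset.mul_sum, ← ih t, Nat.stirlingSecond_succ_succ, Nat.factorial_succ]
      simp
      ring

/-! ### The order of the special linear group. -/

theorem Finset.prod_range_pow_sub_pow (q n : ℕ) :
    ∏ i ∈ Finset.range n, (q ^ n - q ^ i) =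
      q ^ n.choose 2 * ∏ i ∈ Finset.range n, (q ^ (i + 1) - 1) := by
  have h1 : ∀ i ∈ Finset.range n, q ^ n - q ^ i = q ^ i * (q ^ (n - 1 - i + 1) - 1) := by
    intro i hi
    have hi' := Finset.mem_range.mp hi
    rw [Nat.mul_sub, mul_one, ← pow_add]
    congr 2
    omega
  rw [Finset.prod_congr rfl h1, Finset.prod_mul_distrib, Finset.prod_pow_eq_pow_sum,
    Finset.prod_range_reflect (fun i => q ^ (i + 1) - 1) n, Finset.sum_range_id,
    Nat.choose_two_right]

/-- The order of the special linear group over a finite field. -/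
theorem Matrix.card_specialLinearGroup {F : Type*} [Field F] [Fintype F] (n : ℕ) (hn : 0 < n) :
    Nat.card (Matrix.SpecialLinearGroup (Fin n) F) =
      Fintype.card F ^ n.choose 2 * ∏ j ∈ Finset.Icc 2 n, (Fintype.card F ^ j - 1) := by
  classical
  have : Nonempty (Fin n) := ⟨⟨0, hn⟩⟩
  have hq : 0 < Fintype.card F - 1 := Nat.sub_pos_of_lt Fintype.one_lt_card
  have hsurj : Function.Surjective (Matrix.GeneralLinearGroup.det (n := Fin n) (R := F)) :=
    Matrix.GeneralLinearGroup.det_surjective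
  have hrange : (Matrix.SpecialLinearGroup.toGL (n := Fin n) (R := F)).range =
      (Matrix.GeneralLinearGroup.det (n := Fin n) (R := F)).ker := by
    ext g
    rw [MonoidHom.mem_range, MonoidHom.mem_ker]
    constructor
    · rintro ⟨x, rfl⟩
      exact Matrix.SpecialLinearGroup.coeToGL_det x
    · intro hg
      exact ⟨⟨g.1, by simpa using congrArg Units.val hg⟩, by ext; rfl⟩
  have hker : Nat.card (Matrix.GeneralLinearGroup.det (n := Fin n) (R := F)).ker =
      Nat.card (Matrix.SpecialLinearGroup (Fin n) F) := by
    rw [← hrange]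
    exact (Nat.card_congr (MonoidHom.ofInjective
      Matrix.SpecialLinearGroup.toGL_injective).toEquiv).symm
  have hidx := Subgroup.card_eq_card_quotient_mul_card_subgroup
    (Matrix.GeneralLinearGroup.det (n := Fin n) (R := F)).ker
  rw [hker, Nat.card_congr (QuotientGroup.quotientKerEquivOfSurjective _ hsurj).toEquiv,
    Nat.card_eq_fintype_card (α := Fˣ), Fintype.card_units, Matrix.card_GL_field,
    Fin.prod_univ_eq_prod_range (fun i => Fintype.card F ^ n - Fintype.card F ^ i),
    Finset.prod_range_pow_sub_pow] at hidx
  obtain ⟨m, rfl⟩ := Nat.exists_eq_succ_of_ne_zero hn.ne'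
  -- The kernel of `det` has index `q - 1` in `GL`, which cancels the factor `j = 1` of the product.
  refine Nat.eq_of_mul_eq_mul_left hq (hidx.symm.trans ?_)
  have hI : Finset.Icc 2 m.succ = Finset.Ico 2 (m + 2) := rfl
  rw [Finset.prod_range_succ', hI, Finset.prod_Ico_eq_prod_range]
  simp only [zero_add, pow_one, Nat.add_sub_cancel]
  have hP : ∏ i ∈ Finset.range m, (Fintype.card F ^ (i + 1 + 1) - 1) =
      ∏ i ∈ Finset.range m, (Fintype.card F ^ (2 + i) - 1) :=
    Finset.prod_congr rfl fun i _ => by rw [show i + 1 + 1 = 2 + i by ring]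
  rw [hP]
  ring

/-! ### Character sums over matrices of fixed determinant. -/

theorem AddChar.map_sum_eq_prod {A M ι : Type*} [AddCommMonoid A] [CommMonoid M]
    (ψ : AddChar A M) (s : Finset ι) (f : ι → A) : ψ (∑ i ∈ s, f i) = ∏ i ∈ s, ψ (f i) := by
  classical
  induction s using Finset.induction_on with
  | empty => simp
  | insert a s ha ih =>
    rw [Finset.sum_insert ha, Finset.prod_insert ha, AddChar.map_add_eq_mul, ih]

/-- The strictly upper triangular matrix with prescribed entries above the diagonal. -/
def strictUpper {F : Type*} [Zero F] {n : ℕ} (x : {p : Fin n × Fin n // p.1 < p.2} → F) :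
    Matrix (Fin n) (Fin n) F :=
  Matrix.of fun i j => if h : i < j then x ⟨(i, j), h⟩ else 0

theorem card_lt_pairs (n : ℕ) : Fintype.card {p : Fin n × Fin n // p.1 < p.2} = n.choose 2 := by
  rw [Fintype.card_subtype, Fintype.card_product_filter_lt, Fintype.card_fin]

theorem det_diagonal_add_strictUpper {F : Type*} [CommRing F] {n : ℕ} (δ : Fin n → F)
    (x : {p : Fin n × Fin n // p.1 < p.2} → F) :
    (Matrix.diagonal δ + strictUpper x).det = ∏ i, δ i := by
  rw [Matrix.det_of_isUpperTriangular]
  · simp [strictUpper]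
  · intro i j hij
    have hij' : j < i := hij
    simp [strictUpper, hij'.not_gt, hij'.ne']

theorem trace_mul_strictUpper {F : Type*} [CommRing F] {n : ℕ} (g : Matrix (Fin n) (Fin n) F)
    (x : {p : Fin n × Fin n // p.1 < p.2} → F) :
    (g * strictUpper x).trace = ∑ p, x p * g p.1.2 p.1.1 := by
  have h1 : (g * strictUpper x).trace =
      ∑ p : Fin n × Fin n, if h : p.1 < p.2 then x ⟨p, h⟩ * g p.2 p.1 else 0 := by
    rw [Fintype.sum_prod_type, Finset.sum_comm]
    simp only [Matrix.trace, Matrix.diag, Matrix.mul_apply, strictUpper, Matrix.of_apply]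
    refine Finset.sum_congr rfl fun i _ => Finset.sum_congr rfl fun j _ => ?_
    split_ifs <;> ring
  rw [h1, Finset.sum_dite]
  simp only [Finset.sum_const_zero, add_zero]
  refine Finset.sum_bij (fun p _ => ⟨p.1, (Finset.mem_filter.mp p.2).2⟩) (by simp) ?_ ?_ ?_
  · rintro ⟨a, _⟩ _ ⟨b, _⟩ _ h
    simpa using h
  · rintro ⟨p, hp⟩ _
    exact ⟨⟨p, by simpa using hp⟩, by simp, rfl⟩
  · simp

/-- Orthogonality for the additive characters of the space of strictly upper triangular matrices. -/
theorem sum_char_trace_mul_strictUpper {F : Type*} [Field F] [Fintype F] [DecidableEq F]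
    {ψ : AddChar F ℂ} (hψ : ψ.IsPrimitive) {n : ℕ} (g : Matrix (Fin n) (Fin n) F) :
    ∑ x : {p : Fin n × Fin n // p.1 < p.2} → F, ψ (g * strictUpper x).trace =
      if ∀ i j, i < j → g j i = 0 then (Fintype.card F : ℂ) ^ n.choose 2 else 0 := by
  have hsum : ∀ x : {p : Fin n × Fin n // p.1 < p.2} → F, ψ (g * strictUpper x).trace =
      ∏ p, ψ (x p * g p.1.2 p.1.1) := fun x => by
    rw [trace_mul_strictUpper, AddChar.map_sum_eq_prod]
  rw [Finset.sum_congr rfl fun x _ => hsum x]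
  rw [← Fintype.prod_sum (fun (p : {p : Fin n × Fin n // p.1 < p.2}) y => ψ (y * g p.1.2 p.1.1))]
  simp only [AddChar.sum_mulShift _ hψ]
  split_ifs with h
  · rw [Finset.prod_congr rfl fun p _ => by rw [if_pos (h _ _ p.2)]]
    simp [card_lt_pairs]
  · push Not at h
    obtain ⟨i, j, hij, hg⟩ := h
    exact Finset.prod_eq_zero (Finset.mem_univ ⟨(i, j), hij⟩) (by simp [hg])

/-- The additive character sum over the matrices of given determinant reduces to the upper
triangular ones, and hence to a sum over their diagonals. -/
theorem sum_det_eq_char_trace {F : Type*} [Field F] [Fintype F] [DecidableEq F]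
    {ψ : AddChar F ℂ} (hψ : ψ.IsPrimitive) (n : ℕ) (d : F) :
    ∑ g : Matrix (Fin n) (Fin n) F with g.det = d, ψ g.trace =
      (Fintype.card F : ℂ) ^ n.choose 2 *
        ∑ δ : Fin n → F with ∏ i, δ i = d, ψ (∑ i, δ i) := by
  have hq : (Fintype.card F : ℂ) ^ n.choose 2 ≠ 0 := by
    simp [Fintype.card_ne_zero]
  -- Right multiplication by the unipotent `1 + X` permutes the matrices of determinant `d` and
  -- multiplies `ψ(Tr g)` by `ψ(Tr gX)`.
  have hinv : ∀ x : {p : Fin n × Fin n // p.1 < p.2} → F,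
      ∑ g : Matrix (Fin n) (Fin n) F with g.det = d, ψ g.trace =
      ∑ g : Matrix (Fin n) (Fin n) F with g.det = d, ψ g.trace * ψ (g * strictUpper x).trace := by
    intro x
    have hu : (1 + strictUpper x : Matrix (Fin n) (Fin n) F).det = 1 := by
      simpa using det_diagonal_add_strictUpper (fun _ => (1 : F)) x
    have hu' : IsUnit (1 + strictUpper x : Matrix (Fin n) (Fin n) F).det := by simp [hu]
    symm
    refine Finset.sum_bij' (fun g _ => g * (1 + strictUpper x))
      (fun g _ => g * (1 + strictUpper x)⁻¹) ?_ ?_ ?_ ?_ ?_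
    · intro g hg
      simpa [hu] using hg
    · intro g hg
      simpa [hu, Matrix.det_nonsing_inv] using hg
    · intro g _
      rw [Matrix.mul_nonsing_inv_cancel_right _ _ hu']
    · intro g _
      rw [Matrix.nonsing_inv_mul_cancel_right _ _ hu']
    · intro g _
      rw [mul_add, mul_one, Matrix.trace_add, AddChar.map_add_eq_mul]
  -- Sum over all `X`: orthogonality leaves only upper triangular `g`.
  have hleft : (Fintype.card F : ℂ) ^ n.choose 2 *
      ∑ g : Matrix (Fin n) (Fin n) F with g.det = d, ψ g.trace =
      ∑ g : Matrix (Fin n) (Fin n) F with g.det = d,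
        ψ g.trace * (if ∀ i j, i < j → g j i = 0 then (Fintype.card F : ℂ) ^ n.choose 2 else 0) := by
    have hc : (Fintype.card F : ℂ) ^ n.choose 2 =
        Fintype.card ({p : Fin n × Fin n // p.1 < p.2} → F) := by
      simp [card_lt_pairs]
    rw [hc, ← nsmul_eq_mul, ← Finset.card_univ, ← Finset.sum_const,
      Finset.sum_congr rfl fun x _ => hinv x, Finset.sum_comm]
    refine Finset.sum_congr rfl fun g _ => ?_
    rw [← Finset.mul_sum, sum_char_trace_mul_strictUpper hψ, Finset.card_univ, ← hc]
  -- Determinant and trace see only the diagonal, so the strictly upper part is free.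
  have hright : ∑ g : Matrix (Fin n) (Fin n) F with g.det = d,
      (if ∀ i j, i < j → g j i = 0 then ψ g.trace else 0) =
      ∑ δ : Fin n → F with ∏ i, δ i = d, ∑ _x : {p : Fin n × Fin n // p.1 < p.2} → F,
        ψ (∑ i, δ i) := by
    rw [← Finset.sum_filter, Finset.sum_sigma']
    symm
    refine Finset.sum_bij' (fun z _ => Matrix.diagonal z.1 + strictUpper z.2)
      (fun g _ => ⟨fun i => g i i, fun p => g p.1.1 p.1.2⟩) ?_ ?_ ?_ ?_ ?_
    · rintro ⟨δ, x⟩ h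
      simp only [Finset.mem_filter, Finset.mem_univ, true_and, det_diagonal_add_strictUpper]
      refine ⟨by simpa using h, fun i j hij => ?_⟩
      simp [strictUpper, hij.not_gt, hij.ne']
    · intro g h
      simp only [Finset.mem_filter, Finset.mem_univ, true_and] at h
      simp only [Finset.mem_sigma, Finset.mem_filter, Finset.mem_univ, true_and, and_true]
      rw [← h.1, Matrix.det_of_isUpperTriangular]
      intro i j hij
      exact h.2 _ _ hij
    · rintro ⟨δ, x⟩ _
      refine Sigma.ext (funext fun i => by simp [strictUpper]) (heq_of_eq (funext fun p => ?_))
      have := p.2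
      simp [strictUpper, this.ne, this]
    · intro g h
      simp only [Finset.mem_filter, Finset.mem_univ, true_and] at h
      ext i j
      rcases lt_trichotomy i j with hij | rfl | hij
      · simp [strictUpper, hij, hij.ne]
      · simp [strictUpper]
      · simp [strictUpper, hij.not_gt, hij.ne', h.2 j i hij]
    · rintro ⟨δ, x⟩ _
      simp [Matrix.trace, strictUpper]
  refine mul_left_cancel₀ hq ?_
  have hcomm : ∀ g : Matrix (Fin n) (Fin n) F,
      ψ g.trace * (if ∀ i j, i < j → g j i = 0 then (Fintype.card F : ℂ) ^ n.choose 2 else 0) =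
      (Fintype.card F : ℂ) ^ n.choose 2 *
        (if ∀ i j, i < j → g j i = 0 then ψ g.trace else 0) := fun g => by
    split_ifs <;> ring
  rw [hleft, Finset.sum_congr rfl fun g _ => hcomm g, ← Finset.mul_sum, hright]
  simp [Finset.mul_sum, card_lt_pairs]

/-! ### Kloosterman sums and the Gauss sum of `SL`. -/

/-- Since `d ≠ 0`, all coordinates are units, and the first is determined by the others. -/
theorem sum_prod_eq_kloosterman {F : Type*} [Field F] [Fintype F] [DecidableEq F]
    (m : ℕ) (ψ : AddChar F ℂ) (d : Fˣ) :
    ∑ δ : Fin (m + 1) → F with ∏ i, δ i = (d : F), ψ (∑ i, δ i) = kloosterman m ψ d := by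
  have hne : ∀ δ : Fin (m + 1) → F, ∏ i, δ i = d → ∀ i, δ i ≠ 0 := fun δ h i hi =>
    d.ne_zero (h ▸ Finset.prod_eq_zero (Finset.mem_univ i) hi)
  unfold kloosterman
  symm
  refine Finset.sum_bij' (fun α _ => Fin.cons ((d : F) * ∏ i, (α i : F)⁻¹) fun i => (α i : F))
    (fun δ h => fun i => Units.mk0 (δ i.succ) (hne δ (Finset.mem_filter.mp h).2 _))
    ?_ ?_ ?_ ?_ ?_
  · intro α _
    rw [Finset.mem_filter, Fin.prod_univ_succ]
    simp [Finset.prod_inv_distrib, Finset.prod_ne_zero_iff]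
  · simp
  · intro α _
    ext i
    simp
  · intro δ h
    have hδ := (Finset.mem_filter.mp h).2
    have hne' := hne δ hδ
    funext i
    refine Fin.cases ?_ (fun j => ?_) i
    · rw [Fin.prod_univ_succ] at hδ
      have : ∏ i : Fin m, δ i.succ ≠ 0 := Finset.prod_ne_zero_iff.mpr fun i _ => hne' _
      simp [Finset.prod_inv_distrib, ← hδ, this]
    · simp
  · intro α _
    rw [Fin.sum_univ_succ]
    simp [add_comm]

theorem sum_units_prod_eq_kloosterman {F : Type*} [Field F] [Fintype F] [DecidableEq F]
    (m : ℕ) (ψ : AddChar F ℂ) (d : Fˣ) :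
    ∑ α : Fin (m + 1) → Fˣ with ∏ i, α i = d, ψ (∑ i, (α i : F)) = kloosterman m ψ d := by
  rw [← sum_prod_eq_kloosterman]
  refine Finset.sum_bij' (fun α _ i => (α i : F))
    (fun δ h i => Units.mk0 (δ i) fun hi =>
      d.ne_zero ((Finset.mem_filter.mp h).2 ▸ Finset.prod_eq_zero (Finset.mem_univ i) hi))
    ?_ ?_ ?_ ?_ ?_
  · intro α h
    have h' := (Finset.mem_filter.mp h).2
    rw [Finset.mem_filter, ← h', Units.coe_prod]
    simp
  · intro δ h
    have h' := (Finset.mem_filter.mp h).2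
    rw [Finset.mem_filter]
    refine ⟨Finset.mem_univ _, Units.ext ?_⟩
    rw [Units.coe_prod]
    simpa using h'
  · intro α _
    funext i
    ext
    rfl
  · intro δ _
    rfl
  · intro α _
    rfl

/-- Substitute `α_i ↦ a α_i`: the inverse product gains `a^(-m)`, which turns `a^(m+1)` into `a`. -/
theorem kloosterman_mulShift {F : Type*} [Field F] [Fintype F] [DecidableEq F]
    (m : ℕ) (ψ : AddChar F ℂ) (a : Fˣ) :
    kloosterman m (ψ.mulShift a) 1 = kloosterman m ψ (a ^ (m + 1)) := by
  unfold kloosterman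
  refine Fintype.sum_equiv (Equiv.piCongrRight fun _ => Equiv.mulLeft a) _ _ fun α => ?_
  simp only [AddChar.mulShift_apply, Equiv.piCongrRight_apply, Pi.map_apply, Equiv.coe_mulLeft]
  congr 1
  simp only [Units.val_mul, Units.val_one, Units.val_pow_eq_pow_val, mul_inv,
    Finset.prod_mul_distrib, Finset.prod_const, Finset.card_univ, Fintype.card_fin, one_mul,
    mul_add, Finset.mul_sum]
  congr 1
  rw [← mul_assoc, inv_pow, pow_succ', mul_assoc (a : F), mul_inv_cancel₀ (by simp), mul_one]

/-- The Gauss sum of the special linear group is a Kloosterman sum. -/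
theorem sum_specialLinearGroup_char_trace {F : Type*} [Field F] [Fintype F] [DecidableEq F]
    {ψ : AddChar F ℂ} (hψ : ψ.IsPrimitive) (m : ℕ) (a : Fˣ) :
    ∑ g : Matrix.SpecialLinearGroup (Fin (m + 1)) F, ψ (a * g.1.trace) =
      (Fintype.card F : ℂ) ^ (m + 1).choose 2 * kloosterman m ψ (a ^ (m + 1)) := by
  have hψ' : (ψ.mulShift a).IsPrimitive := by
    intro b hb
    rw [AddChar.mulShift_mulShift]
    exact hψ (mul_ne_zero a.ne_zero hb)
  have h := sum_det_eq_char_trace hψ' (m + 1) 1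
  have h2 := sum_prod_eq_kloosterman m (ψ.mulShift a) 1
  rw [Units.val_one] at h2
  rw [h2, kloosterman_mulShift] at h
  rw [← h]
  symm
  refine Finset.sum_bij' (fun g hg => (⟨g, (Finset.mem_filter.mp hg).2⟩ :
    Matrix.SpecialLinearGroup (Fin (m + 1)) F)) (fun g _ => g.1) ?_ ?_ ?_ ?_ ?_
  · exact fun _ _ => Finset.mem_univ _
  · intro g _
    simp
  · exact fun _ _ => rfl
  · intro g _; rfl
  · intro g _
    rfl

theorem sum_eq_zero_add_sum_units {F M : Type*} [Field F] [Fintype F] [DecidableEq F] [AddCommMonoid M]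
    (f : F → M) :
    ∑ a, f a = f 0 + ∑ a : Fˣ, f a := by
  rw [← Finset.add_sum_erase _ _ (Finset.mem_univ (0 : F))]
  congr 1
  refine Finset.sum_bij' (fun a ha => Units.mk0 a (Finset.ne_of_mem_erase ha))
    (fun a _ => (a : F)) ?_ ?_ ?_ ?_ ?_ <;> simp

/-! ### The canonical character and Frobenius invariance. -/

theorem ZMod.eq_zero_or_eq_one_of_two : ∀ c : ZMod 2, c = 0 ∨ c = 1 := by
  decide

section CanonicalChar

variable {F : Type*} [Field F] [Fintype F] [Algebra (ZMod 2) F]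

theorem canonicalChar_apply (x : F) :
    canonicalChar F x = (-1) ^ (Algebra.trace (ZMod 2) F x).val := rfl

theorem canonicalChar_eq_ite (x : F) :
    canonicalChar F x = if Algebra.trace (ZMod 2) F x ≠ 0 then -1 else 1 := by
  rw [canonicalChar_apply]
  rcases ZMod.eq_zero_or_eq_one_of_two (Algebra.trace (ZMod 2) F x) with h | h
  · simp [h]
  · simp [h, ZMod.val_one]

theorem canonicalChar_isPrimitive : (canonicalChar F).IsPrimitive := by
  refine AddChar.IsPrimitive.of_ne_one ?_
  obtain ⟨a, ha⟩ := Algebra.trace_surjective (ZMod 2) F 1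
  refine AddChar.ne_one_iff.mpr ⟨a, ?_⟩
  rw [canonicalChar_apply, ha]
  norm_num [ZMod.val_one]

theorem canonicalChar_sq (x : F) : canonicalChar F (x ^ 2) = canonicalChar F x := by
  have h : Algebra.trace (ZMod 2) F (x ^ 2) = Algebra.trace (ZMod 2) F x := by
    have := Algebra.trace_eq_of_algEquiv (FiniteField.frobeniusAlgEquivOfAlgebraic (ZMod 2) F) x
    simpa using this
  rw [canonicalChar_apply, canonicalChar_apply, h]

variable [DecidableEq F]

/-- Squaring is additive, permutes the units, and leaves `λ` unchanged. -/
theorem kloosterman_canonicalChar_sq (m : ℕ) (a : Fˣ) :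
    kloosterman m (canonicalChar F) (a ^ 2) = kloosterman m (canonicalChar F) a := by
  have : CharP F 2 := charP_of_injective_algebraMap (algebraMap (ZMod 2) F).injective 2
  have hbij : Function.Bijective fun x : Fˣ => x ^ 2 := by
    refine Finite.injective_iff_bijective.mp fun x y hxy => Units.ext ?_
    have hxy' : (x : F) ^ 2 = (y : F) ^ 2 := by simpa using congrArg Units.val hxy
    exact frobenius_inj F 2 hxy'
  unfold kloosterman
  symm
  refine Fintype.sum_equiv (Equiv.piCongrRight fun _ => Equiv.ofBijective _ hbij) _ _ fun α => ?_
  rw [← canonicalChar_sq, CharTwo.add_sq, CharTwo.sum_sq, mul_pow, ← Finset.prod_pow]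
  simp

theorem kloosterman_canonicalChar_pow (m s : ℕ) (a : Fˣ) :
    kloosterman m (canonicalChar F) (a ^ 2 ^ s) = kloosterman m (canonicalChar F) a := by
  induction s with
  | zero => simp
  | succ s ih => rw [pow_succ, pow_mul, kloosterman_canonicalChar_sq, ih]

theorem sum_canonicalChar_mul (x : F) :
    ∑ a : F, canonicalChar F (a * x) = if x = 0 then (Fintype.card F : ℂ) else 0 := by
  have := AddChar.sum_mulShift x (canonicalChar_isPrimitive (F := F))
  rw [this]
  split_ifs <;> simp

theorem sum_units_canonicalChar_mul (x : F) :
    ∑ a : Fˣ, canonicalChar F (a * x) = (if x = 0 then (Fintype.card F : ℂ) else 0) - 1 := by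
  rw [← sum_canonicalChar_mul x, sum_eq_zero_add_sum_units fun a : F => canonicalChar F (a * x)]
  simp

end CanonicalChar

/-! ### Counting elements of `SL` by trace. -/

section TraceCount

variable {F : Type*} [Field F] [Fintype F] [Algebra (ZMod 2) F] [DecidableEq F]

/-- After exchanging sums, the sum over `a` is `q - 1` or `-1`. The part `q` selects the tuples with
`∏ α_i = β⁻¹` (none if `β = 0`); the part `-1` leaves `-(∑_x λ(x))^(k+1)`, where the sum over units
is `-1`. -/
theorem sum_units_canonicalChar_mul_kloosterman (k : ℕ) (β : F) :
    ∑ a : Fˣ, canonicalChar F (a * β) * kloosterman (k + 1) (canonicalChar F) a =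
      (Fintype.card F : ℂ) * theta (k + 2) β - (-1) ^ (k + 1) := by
  have : CharP F 2 := charP_of_injective_algebraMap (algebraMap (ZMod 2) F).injective 2
  have h1 : ∑ a : Fˣ, canonicalChar F (a * β) * kloosterman (k + 1) (canonicalChar F) a =
      ∑ α : Fin (k + 1) → Fˣ, canonicalChar F (∑ i, (α i : F)) *
        ∑ a : Fˣ, canonicalChar F (a * (β + ∏ i, (α i : F)⁻¹)) := by
    simp only [kloosterman, Finset.mul_sum]
    rw [Finset.sum_comm]
    refine Finset.sum_congr rfl fun α _ => Finset.sum_congr rfl fun a _ => ?_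
    rw [← AddChar.map_add_eq_mul, ← AddChar.map_add_eq_mul]
    congr 1
    ring
  have h2 : ∑ α : Fin (k + 1) → Fˣ, canonicalChar F (∑ i, (α i : F)) = (-1) ^ (k + 1) := by
    have hx : ∑ x : Fˣ, canonicalChar F (x : F) = -1 := by
      simpa using sum_units_canonicalChar_mul (1 : F)
    rw [Finset.sum_congr rfl fun α _ => AddChar.map_sum_eq_prod _ _ _,
      ← Fintype.prod_sum (fun (_ : Fin (k + 1)) (x : Fˣ) => canonicalChar F (x : F))]
    simp [hx]
  have h3 : ∑ α : Fin (k + 1) → Fˣ, (if β + ∏ i, (α i : F)⁻¹ = 0 then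
      canonicalChar F (∑ i, (α i : F)) else 0) = theta (k + 2) β := by
    unfold theta
    split_ifs with hβ
    · refine Finset.sum_eq_zero fun α _ => if_neg ?_
      rw [hβ, zero_add]
      exact Finset.prod_ne_zero_iff.mpr fun i _ => by simp
    · rw [Nat.add_sub_cancel, ← sum_units_prod_eq_kloosterman, Finset.sum_filter]
      refine Finset.sum_congr rfl fun α _ => ?_
      congr 1
      rw [CharTwo.add_eq_zero, Finset.prod_inv_distrib, @eq_comm _ β,
        inv_eq_iff_eq_inv, Units.ext_iff]
      simp
  rw [h1, ← h2, ← h3, Finset.mul_sum, ← Finset.sum_sub_distrib]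
  refine Finset.sum_congr rfl fun α _ => ?_
  rw [sum_units_canonicalChar_mul]
  split_ifs <;> ring

theorem sum_specialLinearGroup_canonicalChar (n s : ℕ) (hn : n = 2 ^ s) (a : Fˣ) :
    ∑ g : Matrix.SpecialLinearGroup (Fin n) F, canonicalChar F (a * g.1.trace) =
      (Fintype.card F : ℂ) ^ n.choose 2 * kloosterman (n - 1) (canonicalChar F) a := by
  obtain ⟨m, rfl⟩ : ∃ m, n = m + 1 := ⟨n - 1, by have := Nat.two_pow_pos s; omega⟩
  rw [sum_specialLinearGroup_char_trace canonicalChar_isPrimitive, Nat.add_sub_cancel]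
  congr 1
  rw [hn, kloosterman_canonicalChar_pow]

/-- The number of elements of the special linear group with a given trace. -/
theorem card_mul_traceCount (n s : ℕ) (hs : 0 < s) (hn : n = 2 ^ s) (β : F) :
    (Fintype.card F : ℂ) * traceCount n β =
      Nat.card (Matrix.SpecialLinearGroup (Fin n) F) +
        (Fintype.card F : ℂ) ^ n.choose 2 * ((Fintype.card F : ℂ) * theta n β + 1) := by
  have : CharP F 2 := charP_of_injective_algebraMap (algebraMap (ZMod 2) F).injective 2
  have h1 : (Fintype.card F : ℂ) * traceCount n β =
      ∑ a : F, ∑ g : Matrix.SpecialLinearGroup (Fin n) F,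
        canonicalChar F (a * β) * canonicalChar F (a * g.1.trace) := by
    rw [Finset.sum_comm]
    simp only [← AddChar.map_add_eq_mul, ← mul_add, sum_canonicalChar_mul, CharTwo.add_eq_zero]
    rw [← Finset.sum_filter, Finset.sum_const, traceCount, Nat.card_eq_fintype_card,
      Fintype.card_subtype, nsmul_eq_mul, mul_comm]
    simp only [eq_comm]
  obtain ⟨k, hk⟩ : ∃ k, n = k + 2 := by
    have := Nat.pow_le_pow_right (n := 2) two_pos hs
    exact ⟨n - 2, by omega⟩
  -- Evenness of `n`, from `s > 0`, fixes the sign of the term `+ 1`.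
  have heven : Even n := hn ▸ (Nat.even_pow.mpr ⟨even_two, hs.ne'⟩)
  have hodd : Odd (k + 1) := by
    rw [hk] at heven
    rcases heven with ⟨c, hc⟩
    exact ⟨c - 1, by omega⟩
  have hsum := sum_units_canonicalChar_mul_kloosterman k β
  rw [hodd.neg_one_pow, sub_neg_eq_add, ← hk] at hsum
  rw [h1, sum_eq_zero_add_sum_units, ← hsum, Finset.mul_sum, Nat.card_eq_fintype_card]
  congr 1
  · simp
  · refine Finset.sum_congr rfl fun a _ => ?_
    rw [← Finset.mul_sum, sum_specialLinearGroup_canonicalChar n s hn,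
      show n - 1 = k + 1 by omega]
    ring

theorem traceCount_eq (n s : ℕ) (hs : 0 < s) (hn : n = 2 ^ s) (β : F) :
    (traceCount n β : ℂ) = (Fintype.card F : ℂ) ^ (n.choose 2 - 1) *
      (∏ j ∈ Finset.Icc 2 n, ((Fintype.card F : ℂ) ^ j - 1) + 1 +
        (Fintype.card F : ℂ) * theta n β) := by
  have hq : (Fintype.card F : ℂ) ≠ 0 := by simp [Fintype.card_ne_zero]
  have h2 : 2 ≤ n := by
    rw [hn]
    exact Nat.pow_le_pow_right (n := 2) two_pos hs
  -- As `n ≥ 2`, the exponent is positive and the truncated `- 1` is genuine.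
  have hc : (Fintype.card F : ℂ) ^ n.choose 2 =
      (Fintype.card F : ℂ) * (Fintype.card F : ℂ) ^ (n.choose 2 - 1) := by
    rw [← pow_succ', Nat.sub_add_cancel (Nat.choose_pos h2)]
  have hN : (Nat.card (Matrix.SpecialLinearGroup (Fin n) F) : ℂ) =
      (Fintype.card F : ℂ) ^ n.choose 2 *
        ∏ j ∈ Finset.Icc 2 n, ((Fintype.card F : ℂ) ^ j - 1) := by
    rw [Matrix.card_specialLinearGroup n (by omega)]
    push_cast
    congr 1
    refine Finset.prod_congr rfl fun j _ => ?_
    rw [Nat.cast_sub (Nat.one_le_pow _ _ Fintype.card_pos)]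
    simp
  refine mul_left_cancel₀ hq ?_
  rw [card_mul_traceCount n s hs hn, hN, hc]
  ring

end TraceCount

/-! ### Codewords as zero-sum subsets. -/

/-- The subsets of size `i` of the index type over which the family `v` sums to zero. -/
def zeroSumSubsets {ι F : Type*} [Fintype ι] [AddCommMonoid F] [DecidableEq F] (v : ι → F)
    (i : ℕ) : Finset (Finset ι) :=
  {U ∈ Finset.powersetCard i Finset.univ | ∑ k ∈ U, v k = 0}

theorem mem_zeroSumSubsets {ι F : Type*} [Fintype ι] [AddCommMonoid F] [DecidableEq F]
    {v : ι → F} {i : ℕ} {U : Finset ι} :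
    U ∈ zeroSumSubsets v i ↔ U.card = i ∧ ∑ k ∈ U, v k = 0 := by
  simp [zeroSumSubsets]

/-- Codewords are indicator functions of zero-sum subsets. -/
theorem weightCount_slCode {F : Type*} [Field F] [DecidableEq F] [Algebra (ZMod 2) F] {n N : ℕ}
    (g : Fin N ≃ Matrix.SpecialLinearGroup (Fin n) F) (i : ℕ) :
    weightCount (slCode g) i = (zeroSumSubsets (fun k => Matrix.trace (g k).1) i).card := by
  classical
  have hsum : ∀ u : Fin N → ZMod 2, ∑ k, algebraMap (ZMod 2) F (u k) * Matrix.trace (g k).1 =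
      ∑ k with u k ≠ 0, Matrix.trace (g k).1 := by
    intro u
    rw [Finset.sum_filter]
    refine Finset.sum_congr rfl fun k _ => ?_
    rcases ZMod.eq_zero_or_eq_one_of_two (u k) with h | h <;> simp [h]
  rw [weightCount, Nat.card_eq_fintype_card, Fintype.card_subtype]
  refine Finset.card_bij' (fun u _ => ({k | u k ≠ 0} : Finset (Fin N)))
    (fun U _ k => if k ∈ U then 1 else 0) ?_ ?_ ?_ ?_
  · intro u hu
    obtain ⟨h1, h2⟩ := (Finset.mem_filter.mp hu).2
    exact mem_zeroSumSubsets.mpr ⟨h2, (hsum u).symm.trans h1⟩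
  · intro U hU
    obtain ⟨h1, h2⟩ := mem_zeroSumSubsets.mp hU
    have hU' : ({k | (if k ∈ U then (1 : ZMod 2) else 0) ≠ 0} : Finset (Fin N)) = U := by
      ext k
      simp
    refine Finset.mem_filter.mpr ⟨Finset.mem_univ _, ?_, ?_⟩
    · refine (hsum _).trans ?_
      rw [hU']
      exact h2
    · unfold hammingNorm
      rw [hU']
      exact h1
  · intro u _
    funext k
    have : ∀ c : ZMod 2, (if c ≠ 0 then 1 else 0) = c := by decide
    simpa using this (u k)
  · intro U _
    ext k
    simp

/-- The number of zero-sum subsets of size `i` in terms of the multiplicities of the values. -/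
theorem card_zeroSumSubsets {ι F : Type*} [Fintype ι] [DecidableEq ι] [Field F] [Fintype F]
    [DecidableEq F] (v : ι → F) (i : ℕ) :
    (zeroSumSubsets v i).card =
      ∑ ν ∈ admissible F i, ∏ β : F, (Finset.card {k | v k = β}).choose (ν β) := by
  have hcard : ∀ U : Finset ι, ∑ β : F, (Finset.card {k ∈ U | v k = β}) = U.card := fun U =>
    (Finset.card_eq_sum_card_fiberwise fun _ _ => Finset.mem_coe.mpr (Finset.mem_univ _)).symm
  have hsum : ∀ U : Finset ι, ∑ β : F, (Finset.card {k ∈ U | v k = β} : F) * β = ∑ k ∈ U, v k := by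
    intro U
    rw [← Finset.sum_fiberwise U v v]
    refine Finset.sum_congr rfl fun β _ => ?_
    rw [Finset.sum_congr rfl fun k hk => (Finset.mem_filter.mp hk).2, Finset.sum_const,
      nsmul_eq_mul]
  rw [Finset.card_eq_sum_card_fiberwise (f := fun U β => Finset.card {k ∈ U | v k = β})
    (t := admissible F i)]
  · refine Finset.sum_congr rfl fun ν hν => ?_
    obtain ⟨hν1, hν2⟩ := Finset.mem_filter.mp hν
    rw [Finset.mem_piAntidiag] at hν1
    rw [← Finset.prod_congr rfl fun β _ => Finset.card_powersetCard (ν β) {k | v k = β},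
      ← Fintype.card_piFinset]
    refine Finset.card_bij' (fun U _ β => {k ∈ U | v k = β})
      (fun W _ => ({k | k ∈ W (v k)} : Finset ι)) ?_ ?_ ?_ ?_
    · intro U hU
      have hU' := (Finset.mem_filter.mp hU).2
      rw [Fintype.mem_piFinset]
      intro β
      exact Finset.mem_powersetCard.mpr
        ⟨Finset.filter_subset_filter _ (Finset.subset_univ _), congrFun hU' β⟩
    · intro W hW
      rw [Fintype.mem_piFinset] at hW
      have hcount : (fun β => Finset.card {k ∈ ({k | k ∈ W (v k)} : Finset ι) | v k = β}) = ν := by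
        funext β
        obtain ⟨h1, h2⟩ := Finset.mem_powersetCard.mp (hW β)
        rw [← h2]
        congr 1
        ext k
        simp only [Finset.mem_filter, Finset.mem_univ, true_and]
        constructor
        · rintro ⟨h, rfl⟩
          exact h
        · intro h
          obtain rfl := (Finset.mem_filter.mp (h1 h)).2
          exact ⟨h, rfl⟩
      refine Finset.mem_filter.mpr ⟨mem_zeroSumSubsets.mpr ⟨?_, ?_⟩, hcount⟩
      · rw [← hcard, ← hν1.1]
        exact Finset.sum_congr rfl fun β _ => congrFun hcount β
      · rw [← hsum, ← hν2]
        exact Finset.sum_congr rfl fun β _ => by rw [← congrFun hcount β]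
    · intro U _
      ext k
      simp
    · intro W hW
      rw [Fintype.mem_piFinset] at hW
      funext β
      ext k
      simp only [Finset.mem_filter, Finset.mem_univ, true_and]
      constructor
      · rintro ⟨h, rfl⟩
        exact h
      · intro h
        obtain rfl := (Finset.mem_filter.mp ((Finset.mem_powersetCard.mp (hW β)).1 h)).2
        exact ⟨h, rfl⟩
  · intro U hU
    obtain ⟨h1, h2⟩ := mem_zeroSumSubsets.mp (Finset.mem_coe.mp hU)
    refine Finset.mem_coe.mpr (Finset.mem_filter.mpr ⟨?_, (hsum U).trans h2⟩)
    rw [Finset.mem_piAntidiag]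
    exact ⟨(hcard U).trans h1, fun β _ => Finset.mem_univ β⟩

/-! ### Power moments of the trace words. -/

section PowerMoments

variable {F ι : Type*} [Field F] [Algebra (ZMod 2) F] [Fintype ι]

/-- The Hamming weight of the word `(tr (a v_k))_k`. -/
noncomputable def traceWeight (v : ι → F) (a : F) : ℕ :=
  Finset.card {k | Algebra.trace (ZMod 2) F (a * v k) ≠ 0}

theorem traceWeight_zero (v : ι → F) : traceWeight v 0 = 0 := by
  simp [traceWeight]

variable [Fintype F]

theorem two_mul_traceWeight (v : ι → F) (a : F) :
    (2 : ℂ) * traceWeight v a = Fintype.card ι - ∑ k, canonicalChar F (a * v k) := by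
  have h : (traceWeight v a : ℂ) =
      ∑ k, if Algebra.trace (ZMod 2) F (a * v k) ≠ 0 then (1 : ℂ) else 0 := by
    rw [traceWeight, Finset.sum_boole]
  rw [h, Finset.mul_sum, eq_sub_iff_add_eq, ← Finset.sum_add_distrib]
  rw [Finset.sum_congr rfl fun k _ => show _ = (1 : ℂ) by
    rw [canonicalChar_eq_ite]; split_ifs <;> norm_num]
  simp

variable [DecidableEq ι]

/-- The product of `1 - λ(a v_k)` over `k ∈ T` is `2^t` if `T` lies in the support of the word and
`0` otherwise; expand it over subsets `U` of `T`. -/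
theorem two_pow_mul_choose_traceWeight (v : ι → F) (a : F) (t : ℕ) :
    (2 : ℂ) ^ t * (traceWeight v a).choose t =
      ∑ T ∈ Finset.powersetCard t (Finset.univ : Finset ι), ∑ U ∈ T.powerset,
        (-1) ^ U.card * canonicalChar F (a * ∑ k ∈ U, v k) := by
  have h1 : ∀ T ∈ Finset.powersetCard t (Finset.univ : Finset ι), ∑ U ∈ T.powerset,
      (-1) ^ U.card * canonicalChar F (a * ∑ k ∈ U, v k) =
      if T ⊆ ({k | Algebra.trace (ZMod 2) F (a * v k) ≠ 0} : Finset ι) then 2 ^ t else 0 := by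
    intro T hT
    have hT' := (Finset.mem_powersetCard.mp hT).2
    have h2 : ∏ k ∈ T, (1 + -canonicalChar F (a * v k)) = ∑ U ∈ T.powerset,
        (-1) ^ U.card * canonicalChar F (a * ∑ k ∈ U, v k) := by
      rw [Finset.prod_one_add]
      refine Finset.sum_congr rfl fun U _ => ?_
      rw [Finset.prod_neg, Finset.mul_sum, AddChar.map_sum_eq_prod]
    rw [← h2]
    split_ifs with hs
    · rw [Finset.prod_congr rfl fun k hk => show _ = (2 : ℂ) by
        rw [canonicalChar_eq_ite, if_pos (Finset.mem_filter.mp (hs hk)).2]; norm_num]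
      simp [hT']
    · obtain ⟨k, hk, hk'⟩ := Finset.not_subset.mp hs
      refine Finset.prod_eq_zero hk ?_
      rw [canonicalChar_eq_ite, if_neg (by simpa using hk')]
      norm_num
  rw [Finset.sum_congr rfl h1, ← Finset.sum_filter, Finset.sum_const, nsmul_eq_mul, mul_comm,
    traceWeight, ← Finset.card_powersetCard]
  congr 3
  ext T
  simp only [Finset.mem_filter, Finset.mem_powersetCard]
  exact ⟨fun h => ⟨⟨Finset.subset_univ _, h.2⟩, h.1⟩, fun h => ⟨h.2, h.1.2⟩⟩

variable [DecidableEq F]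

/-- The binomial moments of the weights of the words `(tr (a v_k))_k`, in terms of the weight
distribution of the dual code. -/
theorem sum_two_pow_mul_choose_traceWeight (v : ι → F) (t : ℕ) :
    ∑ a, (2 : ℂ) ^ t * (traceWeight v a).choose t =
      Fintype.card F * ∑ i ∈ Finset.range (t + 1), (-1) ^ i * ((zeroSumSubsets v i).card : ℂ) *
        (Fintype.card ι - i).choose (t - i) := by
  have h1 : ∀ U : Finset ι, ∑ a : F, (-1) ^ U.card * canonicalChar F (a * ∑ k ∈ U, v k) =
      Fintype.card F * ((-1) ^ U.card * if ∑ k ∈ U, v k = 0 then 1 else 0) := by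
    intro U
    rw [← Finset.mul_sum, sum_canonicalChar_mul]
    split_ifs <;> ring
  simp only [two_pow_mul_choose_traceWeight]
  rw [Finset.sum_comm, Finset.mul_sum]
  have h2 : ∀ T ∈ Finset.powersetCard t (Finset.univ : Finset ι),
      ∑ a : F, ∑ U ∈ T.powerset, (-1) ^ U.card * canonicalChar F (a * ∑ k ∈ U, v k) =
      ∑ i ∈ Finset.range (t + 1), ∑ U ∈ Finset.powersetCard i T,
        Fintype.card F * ((-1) ^ U.card * if ∑ k ∈ U, v k = 0 then (1 : ℂ) else 0) := by
    intro T hT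
    rw [Finset.sum_comm, Finset.sum_congr rfl fun U _ => h1 U, Finset.sum_powerset,
      (Finset.mem_powersetCard.mp hT).2]
  rw [Finset.sum_congr rfl h2, Finset.sum_comm]
  refine Finset.sum_congr rfl fun i hi => ?_
  have hit : i ≤ t := Nat.lt_succ_iff.mp (Finset.mem_range.mp hi)
  -- Count pairs `U ⊆ T` from `U`: each `i`-set lies in `C(N-i, t-i)` sets of size `t`.
  rw [Finset.sum_comm' (t' := Finset.powersetCard i Finset.univ)
    (s' := fun U => {T ∈ Finset.powersetCard t (Finset.univ : Finset ι) | U ⊆ T})]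
  · have h3 : ∀ U ∈ Finset.powersetCard i (Finset.univ : Finset ι),
        ∑ _T ∈ Finset.powersetCard t (Finset.univ : Finset ι) with U ⊆ _T,
          (Fintype.card F : ℂ) * ((-1) ^ U.card * if ∑ k ∈ U, v k = 0 then (1 : ℂ) else 0) =
        (Fintype.card F : ℂ) * (-1) ^ i * (Fintype.card ι - i).choose (t - i) *
          if ∑ k ∈ U, v k = 0 then (1 : ℂ) else 0 := by
      intro U hU
      have hU' := (Finset.mem_powersetCard.mp hU).2
      rw [Finset.sum_const, Finset.card_filter_powersetCard_subset _ _ _ (Finset.subset_univ _)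
        (hU'.trans_le hit), hU', Finset.card_univ, nsmul_eq_mul]
      ring
    rw [Finset.sum_congr rfl h3, ← Finset.mul_sum, ← Finset.sum_filter, Finset.sum_const,
      nsmul_eq_mul, zeroSumSubsets]
    ring
  · intro T U
    simp only [Finset.mem_powersetCard, Finset.mem_filter, Finset.subset_univ, true_and]
    tauto

/-- The power moment identity for the words `(tr (a v_k))_k`. -/
theorem sum_two_mul_traceWeight_pow (v : ι → F) (h : ℕ) :
    ∑ a, ((2 : ℂ) * traceWeight v a) ^ h =
      Fintype.card F * ∑ i ∈ Finset.range (h + 1), (-1) ^ i * ((zeroSumSubsets v i).card : ℂ) *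
        ∑ t ∈ Finset.Icc i h, (t.factorial : ℂ) * (h.stirlingSecond t : ℂ) * 2 ^ (h - t) *
          (Fintype.card ι - i).choose (t - i) := by
  have h1 : ∀ a, ((2 : ℂ) * traceWeight v a) ^ h = ∑ t ∈ Finset.range (h + 1),
      (t.factorial : ℂ) * (h.stirlingSecond t : ℂ) * 2 ^ (h - t) *
        (2 ^ t * (traceWeight v a).choose t) := by
    intro a
    rw [mul_pow, ← Nat.cast_pow, Nat.pow_eq_sum_stirlingSecond_mul_descFactorial, Nat.cast_sum,
      Finset.mul_sum]
    refine Finset.sum_congr rfl fun t ht => ?_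
    have hth : t ≤ h := Nat.lt_succ_iff.mp (Finset.mem_range.mp ht)
    rw [Nat.descFactorial_eq_factorial_mul_choose, ← Nat.sub_add_cancel hth, pow_add,
      Nat.sub_add_cancel hth]
    push_cast
    ring
  rw [Finset.sum_congr rfl fun a _ => h1 a, Finset.sum_comm]
  rw [Finset.sum_congr rfl fun t _ => by
    rw [← Finset.mul_sum, sum_two_pow_mul_choose_traceWeight]]
  simp only [Finset.mul_sum]
  rw [Finset.sum_comm' (t' := Finset.range (h + 1)) (s' := fun i => Finset.Icc i h)]
  · refine Finset.sum_congr rfl fun i _ => Finset.sum_congr rfl fun t _ => ?_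
    ring
  · intro t i
    simp only [Finset.mem_range, Finset.mem_Icc]
    omega

end PowerMoments

/-! ### Assembling the recursion. -/

/-- Symmetry of binomials if `t ≤ N`. If `t > N` both sides vanish, whereas a truncated `N - t`
would wrongly give `1`; hence integer arguments. -/
theorem intBinom_sub_sub {N i t : ℕ} (hi : i ≤ N) (hit : i ≤ t) :
    intBinom ((N : ℤ) - i) ((N : ℤ) - t) = (N - i).choose (t - i) := by
  unfold intBinom
  split_ifs with h
  · have ht : t ≤ N := by omega
    rw [← Nat.cast_sub hi, ← Nat.cast_sub ht, Int.toNat_natCast, Int.toNat_natCast,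
      ← Nat.choose_symm (show N - t ≤ N - i by omega)]
    congr 1
    omega
  · exact (Nat.choose_eq_zero_of_lt (by omega)).symm

theorem traceCount_eq_card_filter {F : Type*} [Field F] [DecidableEq F] {n N : ℕ}
    (g : Fin N ≃ Matrix.SpecialLinearGroup (Fin n) F) (β : F) :
    traceCount n β = Finset.card {k | Matrix.trace (g k).1 = β} := by
  rw [traceCount, ← Fintype.card_subtype, ← Nat.card_eq_fintype_card]
  exact Nat.card_congr (g.subtypeEquiv fun _ => Iff.rfl).symm

/-- The binomial expansion of the power moments of the weights of the dual code. -/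
theorem sum_choose_mul_kloostermanMoment {F : Type*} [Field F] [Fintype F] [DecidableEq F]
    [Algebra (ZMod 2) F] (s n N : ℕ) (hn : n = 2 ^ s)
    (g : Fin N ≃ Matrix.SpecialLinearGroup (Fin n) F) (h : ℕ) (hh : 0 < h) :
    ∑ a : F, ((2 : ℂ) * traceWeight (fun k => Matrix.trace (g k).1) a) ^ h =
      ∑ i ∈ Finset.range (h + 1), (-1 : ℂ) ^ i * (h.choose i : ℂ) * (N : ℂ) ^ (h - i) *
        (Fintype.card F : ℂ) ^ (n.choose 2 * i) * kloostermanMoment F (n - 1) i := by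
  have h1 : ∀ a : Fˣ, (2 : ℂ) * traceWeight (fun k => Matrix.trace (g k).1) (a : F) =
      -((Fintype.card F : ℂ) ^ n.choose 2 * kloosterman (n - 1) (canonicalChar F) a) + N := by
    intro a
    rw [two_mul_traceWeight, ← sum_specialLinearGroup_canonicalChar n s hn,
      Fintype.card_fin, Equiv.sum_comp g fun x => canonicalChar F (a * x.1.trace)]
    ring
  -- The term `a = 0` is `0^h`, which vanishes because `h > 0`.
  rw [sum_eq_zero_add_sum_units, traceWeight_zero]
  simp only [Nat.cast_zero, mul_zero, zero_pow hh.ne', zero_add, h1, add_pow]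
  rw [Finset.sum_comm]
  refine Finset.sum_congr rfl fun i _ => ?_
  rw [kloostermanMoment, Finset.mul_sum]
  refine Finset.sum_congr rfl fun a _ => ?_
  rw [neg_pow, mul_pow, pow_mul]
  ring

theorem theorem1 {F : Type*} [Field F] [Fintype F] [DecidableEq F] [Algebra (ZMod 2) F]
    (s r n q N : ℕ) (hs : 0 < s) (hr : 0 < r) (hn : n = 2 ^ s) (hq : q = 2 ^ r)
    (hF : Fintype.card F = q)
    (g : Fin N ≃ Matrix.SpecialLinearGroup (Fin n) F) :
    -- the recursive formula for the moments
    (∀ h : ℕ, 0 < h →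
      (q : ℂ) ^ (n.choose 2 * h) * kloostermanMoment F (n - 1) h =
        ∑ i ∈ Finset.range h, (-1 : ℂ) ^ (h + i + 1) * (h.choose i : ℂ) * (N : ℂ) ^ (h - i) *
          (q : ℂ) ^ (n.choose 2 * i) * kloostermanMoment F (n - 1) i
        + (q : ℂ) * ∑ i ∈ Finset.range (min N h + 1),
            (-1 : ℂ) ^ (h + i) * (weightCount (slCode g) i : ℂ) *
              ∑ t ∈ Finset.Icc i h, (t.factorial : ℂ) * (Nat.stirlingSecond h t : ℂ) *
                2 ^ (h - t) * (intBinom ((N : ℤ) - i) ((N : ℤ) - t) : ℂ)) ∧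
    -- the order of the special linear group
    N = q ^ n.choose 2 * ∏ j ∈ Finset.Icc 2 n, (q ^ j - 1) ∧
    -- the explicit form of the Stirling numbers of the second kind
    (∀ h t : ℕ, 0 < h →
      (Nat.stirlingSecond h t : ℚ) = 1 / (t.factorial : ℚ) *
        ∑ j ∈ Finset.range (t + 1), (-1 : ℚ) ^ (t - j) * (t.choose j : ℚ) * (j : ℚ) ^ h) ∧
    -- the weight distribution of the code
    (∀ i : ℕ, i ≤ N →
      weightCount (slCode g) i =
        ∑ ν ∈ admissible F i, ∏ β : F, (traceCount n β).choose (ν β)) ∧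
    -- the number of elements with a given trace
    (∀ β : F,
      (traceCount n β : ℂ) = (q : ℂ) ^ (n.choose 2 - 1) *
        (∏ j ∈ Finset.Icc 2 n, ((q : ℂ) ^ j - 1) + 1 + (q : ℂ) * theta n β)) := by
  subst hF
  refine ⟨fun h hh => ?_, ?_, fun h t _ => ?_, fun i _ => ?_, traceCount_eq n s hs hn⟩
  · have hbin := sum_choose_mul_kloostermanMoment s n N hn g h hh
    rw [sum_two_mul_traceWeight_pow, Fintype.card_fin] at hbin
    -- There are no `i`-subsets for `i > N`, so the sum may stop at `min N h`.
    have hrange : ∑ i ∈ Finset.range (h + 1), (-1 : ℂ) ^ i *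
        ((zeroSumSubsets (fun k => Matrix.trace (g k).1) i).card : ℂ) *
        ∑ t ∈ Finset.Icc i h, (t.factorial : ℂ) * (h.stirlingSecond t : ℂ) * 2 ^ (h - t) *
          ((N - i).choose (t - i) : ℂ) =
        ∑ i ∈ Finset.range (min N h + 1), (-1 : ℂ) ^ i * (weightCount (slCode g) i : ℂ) *
          ∑ t ∈ Finset.Icc i h, (t.factorial : ℂ) * (h.stirlingSecond t : ℂ) * 2 ^ (h - t) *
            (intBinom ((N : ℤ) - i) ((N : ℤ) - t) : ℂ) := by
      symm
      refine Finset.sum_subset_zero_on_sdiff ?_ ?_ ?_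
      · exact Finset.range_subset_range.mpr (by omega)
      · intro i hi
        simp only [Finset.mem_sdiff, Finset.mem_range] at hi
        have hempty : (zeroSumSubsets (fun k => Matrix.trace (g k).1) i).card = 0 := by
          rw [Finset.card_eq_zero, zeroSumSubsets,
            Finset.powersetCard_eq_empty.mpr (by simp; omega), Finset.filter_empty]
        simp [hempty]
      · intro i hi
        have hi' : i ≤ N := by
          have := Finset.mem_range.mp hi
          omega
        rw [weightCount_slCode]
        congr 1
        refine Finset.sum_congr rfl fun t ht => ?_
        rw [intBinom_sub_sub hi' (Finset.mem_Icc.mp ht).1]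
    -- The term `i = h` is `(-1)^h` times the wanted left side; multiplying by `(-1)^h` isolates it.
    rw [hrange, Finset.sum_range_succ _ h] at hbin
    simp only [Nat.choose_self, Nat.sub_self, pow_zero, Nat.cast_one, mul_one] at hbin
    have hsq : (-1 : ℂ) ^ h * (-1) ^ h = 1 := by
      rw [← mul_pow]
      simp
    have e1 : ∑ i ∈ Finset.range h, (-1 : ℂ) ^ (h + i + 1) * (h.choose i : ℂ) *
        (N : ℂ) ^ (h - i) * (Fintype.card F : ℂ) ^ (n.choose 2 * i) *
          kloostermanMoment F (n - 1) i =
        -(-1) ^ h * ∑ i ∈ Finset.range h, (-1 : ℂ) ^ i * (h.choose i : ℂ) *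
        (N : ℂ) ^ (h - i) * (Fintype.card F : ℂ) ^ (n.choose 2 * i) *
          kloostermanMoment F (n - 1) i := by
      rw [Finset.mul_sum]
      refine Finset.sum_congr rfl fun i _ => ?_
      ring
    have e2 : ∀ f : ℕ → ℂ, ∑ i ∈ Finset.range (min N h + 1), (-1 : ℂ) ^ (h + i) *
        (weightCount (slCode g) i : ℂ) * f i = (-1) ^ h *
        ∑ i ∈ Finset.range (min N h + 1), (-1 : ℂ) ^ i * (weightCount (slCode g) i : ℂ) * f i := by
      intro f
      rw [Finset.mul_sum]
      refine Finset.sum_congr rfl fun i _ => ?_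
      ring
    rw [e1, e2]
    linear_combination (-(Fintype.card F : ℂ) ^ (n.choose 2 * h) *
      kloostermanMoment F (n - 1) h) * hsq - (-1 : ℂ) ^ h * hbin
  · rw [← Matrix.card_specialLinearGroup n (hn ▸ Nat.two_pow_pos s), ← Nat.card_congr g,
      Nat.card_eq_fintype_card, Fintype.card_fin]
  · rw [← Nat.factorial_mul_stirlingSecond, ← mul_assoc, one_div_mul_cancel, one_mul]
    exact_mod_cast t.factorial_ne_zero
  · rw [weightCount_slCode, card_zeroSumSubsets]
    simp only [traceCount_eq_card_filter g]
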